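/- Let $G$ be a finite group with Fitting subgroup $F(G)$ (the largest nilpotent normal subgroup). Let $\nu_1(G)$ be the smallest normal subgroup $N$ of $F(G)$ such that $F(G)/N$ is a direct product of elementary abelian groups that is centralized by $F(G)$. Let $\ell = |F(G)/\nu_1(G)|$ be the $F$-rank of $G$, and let $k$ be the product of the distinct primes dividing $\ell$ (so $k=1$ if $\ell=1$). Let $n$ be a natural number and let $F$ be a free group on $n$ generators. For an epimorphism $\mu : F \to G$ put $R = \ker\mu$ and $L = \mu^{-1}(F(G))$. For a positive integer $m$ let $R^m$ be the subgroup generated by the $m$-th powers of the elements of $R$. Define, for each prime $p$, $$G^*_p(\mu) = F/[R,L]R^p \qquad\text{and}\qquad G^*(\mu) = F/[R,L]R^k .$$ Then for any two epimorphisms $\mu_1,\mu_2 : F \to G$: 1. $G^*_p(\mu_1) \cong G^*_p(\mu_2)$ for every prime $p$ (in particular for every prime $p$ dividing $\ell$); 2. $G^*(\mu_1) \cong G^*(\mu_2)$. That is, the isomorphism type of the $p$-covering group depends only on $G$, $n$ and $p$, and that of the covering group depends only on $G$ and $n$, but not on the epimorphism. -/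

import Mathlib

/-- The Fitting subgroup: generated by all nilpotent normal subgroups. In a finite group it is
the largest nilpotent normal subgroup. -/
def fittingSubgroup (G : Type*) [Group G] : Subgroup G :=
  sSup {N : Subgroup G | N.Normal ∧ Group.IsNilpotent N}

instance fittingSubgroup_normal (G : Type*) [Group G] : (fittingSubgroup G).Normal :=
  Subgroup.sSup_normal _ (fun _ hN => hN.1)

/-- `Q` is a finite direct product of elementary abelian groups, that is, of cyclic groups
of prime order (the primes may differ, and the product may be empty). -/
def IsProdElementaryAbelian (Q : Type*) [Group Q] : Prop :=
  ∃ (m : ℕ) (p : Fin m → ℕ), (∀ i, (p i).Prime) ∧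
    Nonempty (Q ≃* Multiplicative (∀ i, ZMod (p i)))

/-- `N ≤ A` is a normal subgroup of the Fitting subgroup such that `A / N` is a direct product of
elementary abelian groups that is centralized by the Fitting subgroup. -/
def IsFCentralStep {G : Type*} [Group G] (A N : Subgroup G) : Prop :=
  N ≤ A ∧ N ≤ fittingSubgroup G ∧ (N.subgroupOf (fittingSubgroup G)).Normal ∧
    (∃ _ : (N.subgroupOf A).Normal, IsProdElementaryAbelian (A ⧸ N.subgroupOf A)) ∧
    ⁅fittingSubgroup G, A⁆ ≤ N

/-- The `F`-central series `ν₀(G) ≥ ν₁(G) ≥ …`: `ν₀(G)` is the Fitting subgroup, and `νᵢ₊₁(G)` is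
the smallest subgroup `N` with `IsFCentralStep (νᵢ(G)) N`. -/
def fCentralSeries (G : Type*) [Group G] : ℕ → Subgroup G
  | 0 => fittingSubgroup G
  | i + 1 => sInf {N : Subgroup G | IsFCentralStep (fCentralSeries G i) N}

/-- The `F`-rank `|ν₀(G) / ν₁(G)|`. -/
noncomputable def fRank (G : Type*) [Group G] : ℕ :=
  (fCentralSeries G 1).relIndex (fCentralSeries G 0)

/-- The core of `m`: the product of the distinct primes that divide `m`. -/
def natCore (m : ℕ) : ℕ := ∏ p ∈ m.primeFactors, p

/-- `R ^ m`: the subgroup generated by the `m`-th powers of the elements of `R`. -/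
def powerSubgroup {F : Type*} [Group F] (R : Subgroup F) (m : ℕ) : Subgroup F :=
  Subgroup.closure {y | ∃ x ∈ R, y = x ^ m}

instance powerSubgroup_normal {F : Type*} [Group F] (R : Subgroup F) [hR : R.Normal] (m : ℕ) :
    (powerSubgroup R m).Normal := by
  have h : Group.conjugatesOfSet {y | ∃ x ∈ R, y = x ^ m} = {y | ∃ x ∈ R, y = x ^ m} := by
    refine Set.Subset.antisymm ?_ Group.subset_conjugatesOfSet
    intro z hz
    obtain ⟨y, ⟨x, hx, rfl⟩, hyz⟩ := Group.mem_conjugatesOfSet_iff.1 hz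
    obtain ⟨c, rfl⟩ := isConj_iff.1 hyz
    exact ⟨c * x * c⁻¹, hR.conj_mem x hx c, conj_pow.symm⟩
  have h2 : powerSubgroup R m = Subgroup.normalClosure {y | ∃ x ∈ R, y = x ^ m} := by
    rw [Subgroup.normalClosure, h, powerSubgroup]
  rw [h2]
  infer_instance

/-- For `μ : F → G` with kernel `R`, and `L` the full preimage of the Fitting subgroup of `G`,
the subgroup `[R, L] R ^ m` of `F`. -/
def coverKernel {F G : Type*} [Group F] [Group G] (μ : F →* G) (m : ℕ) : Subgroup F :=
  ⁅μ.ker, (fittingSubgroup G).comap μ⁆ ⊔ powerSubgroup μ.ker m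

instance coverKernel_normal {F G : Type*} [Group F] [Group G] (μ : F →* G) (m : ℕ) :
    (coverKernel μ m).Normal := by
  unfold coverKernel
  infer_instance

/-- The `p`-covering group `F / [R, L] R ^ p` associated with `μ`. -/
abbrev PCoveringGroup {F G : Type*} [Group F] [Group G] (μ : F →* G) (p : ℕ) : Type _ :=
  F ⧸ coverKernel μ p

/-- The covering group `F / [R, L] R ^ k` associated with `μ`, where `k` is the core of the
`F`-rank of `G`. -/
abbrev CoveringGroup {F G : Type*} [Group F] [Group G] (μ : F →* G) : Type _ :=
  F ⧸ coverKernel μ (natCore (fRank G))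

/-!
Let `π : E → G` be an extension whose kernel has exponent dividing `m` and is centralized by
`π⁻¹(F(G))`. Every lift `F → E` of `μ : F → G` factors through `F / [R, L] R ^ m`, which is itself
such an extension of `G`, with finite kernel. It therefore suffices to lift each of the two
epimorphisms `F → G` to an *epimorphism* onto the covering group of the other. Gaschütz's lemma
provides these lifts: for a homomorphism with finite kernel, the number of generating tuples above
a generating tuple `g` of the quotient does not depend on `g`. The resulting epimorphisms between
the covering groups restrict to epimorphisms between the finite kernels, and so they are injective.
-/

section Gaschutz

variable {ι E Q : Type*} [Group E] [Group Q] {f : E →* Q} {g g' : ι → Q} {H K : Subgroup E}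

/-- The tuples in a subgroup `H` that lift the tuple `g` along `f`. -/
def liftsIn (f : E →* Q) (g : ι → Q) (H : Subgroup E) : Set (ι → E) :=
  {x | (∀ i, x i ∈ H) ∧ ∀ i, f (x i) = g i}

/-- The tuples that lift the tuple `g` along `f` and generate exactly the subgroup `H`. -/
def generatingLifts (f : E →* Q) (g : ι → Q) (H : Subgroup E) : Set (ι → E) :=
  {x | Subgroup.closure (Set.range x) = H ∧ ∀ i, f (x i) = g i}

theorem mem_liftsIn_iff_closure_le {x : ι → E} :
    x ∈ liftsIn f g H ↔ Subgroup.closure (Set.range x) ≤ H ∧ ∀ i, f (x i) = g i := by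
  rw [Subgroup.closure_le, Set.range_subset_iff]
  rfl

theorem generatingLifts_subset_liftsIn : generatingLifts f g H ⊆ liftsIn f g H :=
  fun _ hx => mem_liftsIn_iff_closure_le.2 ⟨hx.1.le, hx.2⟩

theorem finite_liftsIn [Finite ι] [Finite f.ker] : (liftsIn f g H).Finite := by
  have finite_fiber (q : Q) : (f ⁻¹' {q}).Finite := by
    obtain hq | ⟨a, rfl⟩ := (f ⁻¹' {q}).eq_empty_or_nonempty
    · exact hq ▸ Set.finite_empty
    · exact Finite.of_equiv _ (f.fiberEquivKer a).symm
  exact (Set.Finite.pi' fun i => finite_fiber (g i)).subset fun _ hx => hx.2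

theorem finite_generatingLifts [Finite ι] [Finite f.ker] : (generatingLifts f g H).Finite :=
  finite_liftsIn.subset generatingLifts_subset_liftsIn

theorem ncard_liftsIn_eq (hH : H.map f = ⊤) : (liftsIn f g H).ncard = (liftsIn f g' H).ncard := by
  have exists_correction (i : ι) : ∃ t ∈ H, f t = (g i)⁻¹ * g' i :=
    Subgroup.mem_map.1 (hH ▸ Subgroup.mem_top _)
  choose t htH htf using exists_correction
  refine Nat.card_congr ((Equiv.mulRight t).subtypeEquiv fun x => and_congr ?_ ?_)
  · exact forall_congr' fun i => (H.mul_mem_cancel_right (htH i)).symm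
  · refine forall_congr' fun i => ?_
    simp only [Equiv.coe_mulRight, Pi.mul_apply, map_mul, htf, ← mul_assoc, mul_eq_right,
      mul_inv_eq_one]

theorem ncard_liftsIn_diff_generatingLifts :
    (liftsIn f g H \ generatingLifts f g H).ncard =
      Nat.card (Σ K : {K // K < H}, generatingLifts f g K.1) :=
  Nat.card_congr
    { toFun x :=
        have hx := mem_liftsIn_iff_closure_le.1 x.2.1
        ⟨⟨_, hx.1.lt_of_ne fun h => x.2.2 ⟨h, hx.2⟩⟩, ⟨x, rfl, hx.2⟩⟩
      invFun y :=
        ⟨y.2, mem_liftsIn_iff_closure_le.2 ⟨y.2.2.1.trans_le y.1.2.le, y.2.2.2⟩,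
          fun h => y.1.2.ne (y.2.2.1.symm.trans h.1)⟩
      left_inv _ := rfl
      right_inv := by
        rintro ⟨⟨K, hKH⟩, ⟨x, hx : _ = K, _⟩⟩
        subst hx
        rfl }

theorem generatingLifts_eq_empty (hg : Subgroup.closure (Set.range g) = ⊤) (hH : H.map f ≠ ⊤) :
    generatingLifts f g H = ∅ := by
  refine Set.eq_empty_of_forall_notMem fun x ⟨hx, hfx⟩ => hH ?_
  rw [← hx, MonoidHom.map_closure, ← Set.range_comp, ← hg]
  exact congrArg (fun y => Subgroup.closure (Set.range y)) (funext hfx)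

theorem card_inf_ker_lt [Finite f.ker] (hKH : K < H) (hK : K.map f = ⊤) :
    Nat.card ↥(K ⊓ f.ker) < Nat.card ↥(H ⊓ f.ker) := by
  have : Finite ↥(H ⊓ f.ker) := Finite.Set.finite_inter_of_right _ _
  refine lt_of_not_ge fun hcard => hKH.not_ge fun h hh => ?_
  have inf_eq : K ⊓ f.ker = H ⊓ f.ker :=
    Subgroup.eq_of_le_of_card_ge (inf_le_inf_right _ hKH.le) hcard
  obtain ⟨k, hk, hkh⟩ : f h ∈ K.map f := hK ▸ Subgroup.mem_top _
  have quot_mem : k⁻¹ * h ∈ K ⊓ f.ker :=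
    inf_eq ▸ ⟨H.mul_mem (H.inv_mem (hKH.le hk)) hh, by simp [hkh]⟩
  exact (K.mul_mem_cancel_left (K.inv_mem hk)).1 quot_mem.1

theorem ncard_generatingLifts_eq [Finite ι] [Finite f.ker]
    (hg : Subgroup.closure (Set.range g) = ⊤) (hg' : Subgroup.closure (Set.range g') = ⊤)
    (H : Subgroup E) : (generatingLifts f g H).ncard = (generatingLifts f g' H).ncard := by
  induction H using (measure fun H : Subgroup E => Nat.card ↥(H ⊓ f.ker)).wf.induction with
  | _ H ih =>
  by_cases hH : H.map f = ⊤
  · have fiber_equiv (K : {K // K < H}) :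
        Nonempty (generatingLifts f g K.1 ≃ generatingLifts f g' K.1) := by
      have := (finite_generatingLifts (f := f) (g := g) (H := K.1)).to_subtype
      have := (finite_generatingLifts (f := f) (g := g') (H := K.1)).to_subtype
      refine Finite.card_eq.1 ?_
      by_cases hK : K.1.map f = ⊤
      · exact ih K (card_inf_ker_lt K.2 hK)
      · rw [generatingLifts_eq_empty hg hK, generatingLifts_eq_empty hg' hK]
    have diff_eq := Nat.card_congr (Equiv.sigmaCongrRight fun K => (fiber_equiv K).some)
    rw [← ncard_liftsIn_diff_generatingLifts, ← ncard_liftsIn_diff_generatingLifts] at diff_eq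
    have split (g : ι → Q) := Set.ncard_sdiff_add_ncard_of_subset
      (generatingLifts_subset_liftsIn (f := f) (g := g) (H := H)) finite_liftsIn
    have total_eq : (liftsIn f g H).ncard = (liftsIn f g' H).ncard := ncard_liftsIn_eq hH
    rw [← split g, ← split g', diff_eq] at total_eq
    exact Nat.add_left_cancel total_eq
  · rw [generatingLifts_eq_empty hg hH, generatingLifts_eq_empty hg' hH]

/-- **Gaschütz's lemma** -/
theorem exists_closure_range_eq_top_lift [Finite ι] [Finite f.ker] (hf : Function.Surjective f)
    {x : ι → E} (hx : Subgroup.closure (Set.range x) = ⊤)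
    (hg : Subgroup.closure (Set.range g) = ⊤) :
    ∃ y : ι → E, Subgroup.closure (Set.range y) = ⊤ ∧ ∀ i, f (y i) = g i := by
  have hfx : Subgroup.closure (Set.range (f ∘ x)) = ⊤ := by
    rw [Set.range_comp, ← MonoidHom.map_closure, hx, Subgroup.map_top_of_surjective f hf]
  have ncard_pos : 0 < (generatingLifts f (f ∘ x) ⊤).ncard :=
    (Set.ncard_pos finite_generatingLifts).2 ⟨x, hx, fun _ => rfl⟩
  rw [ncard_generatingLifts_eq hfx hg] at ncard_pos
  exact (Set.ncard_pos finite_generatingLifts).1 ncard_pos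

theorem exists_surjective_lift_of_finite_ker [Finite ι] [Finite f.ker]
    (hf : Function.Surjective f) {ψ : FreeGroup ι →* E} (hψ : Function.Surjective ψ)
    {μ : FreeGroup ι →* Q} (hμ : Function.Surjective μ) :
    ∃ φ : FreeGroup ι →* E, Function.Surjective φ ∧ f.comp φ = μ := by
  obtain ⟨x, rfl⟩ := FreeGroup.lift.surjective ψ
  obtain ⟨g, rfl⟩ := FreeGroup.lift.surjective μ
  rw [FreeGroup.lift_surjective_iff_closure_range_eq_top] at hψ hμ
  obtain ⟨y, hy, hfy⟩ := exists_closure_range_eq_top_lift hf hψ hμ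
  exact ⟨FreeGroup.lift y, FreeGroup.lift_surjective_iff_closure_range_eq_top.2 hy,
    FreeGroup.ext_hom _ _ fun i => by simp [hfy]⟩

end Gaschutz

section MutualEpimorphisms

variable {E₁ E₂ G : Type*} [Group E₁] [Group E₂] [Group G] {π₁ : E₁ →* G} {π₂ : E₂ →* G}

theorem card_ker_le_card_ker_comp {θ : E₁ →* E₂} (hθ : Function.Surjective θ)
    [Finite (π₂.comp θ).ker] : Nat.card π₂.ker ≤ Nat.card (π₂.comp θ).ker :=
  Nat.card_le_card_of_surjective _ (θ.subgroupComap_surjective_of_surjective π₂.ker hθ)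

theorem injective_of_surjective_of_card_ker_eq [Finite π₁.ker] {θ : E₁ →* E₂}
    (hθ : Function.Surjective θ) (hπ : π₂.comp θ = π₁)
    (hcard : Nat.card π₁.ker = Nat.card π₂.ker) : Function.Injective θ := by
  subst hπ
  have : Finite (π₂.ker.comap θ) := ‹Finite (π₂.comp θ).ker›
  have restrict_bijective : Function.Bijective (θ.subgroupComap π₂.ker) :=
    (Nat.bijective_iff_surjective_and_card _).2
      ⟨θ.subgroupComap_surjective_of_surjective π₂.ker hθ, hcard⟩
  refine (injective_iff_map_eq_one θ).2 fun a ha => ?_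
  have ha' : a ∈ π₂.ker.comap θ := by simp [ha]
  exact congrArg Subtype.val <|
    (injective_iff_map_eq_one _).1 restrict_bijective.1 ⟨a, ha'⟩ (Subtype.ext ha)

theorem exists_mulEquiv_of_surjective_of_surjective [Finite π₁.ker] [Finite π₂.ker]
    {θ : E₁ →* E₂} (hθ : Function.Surjective θ) (hπθ : π₂.comp θ = π₁)
    {η : E₂ →* E₁} (hη : Function.Surjective η) (hπη : π₁.comp η = π₂) :
    ∃ e : E₁ ≃* E₂, π₂.comp e.toMonoidHom = π₁ := by
  have : Finite (π₂.comp θ).ker := hπθ ▸ ‹_›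
  have : Finite (π₁.comp η).ker := hπη ▸ ‹_›
  have hcard : Nat.card π₁.ker = Nat.card π₂.ker := le_antisymm
    (hπη ▸ card_ker_le_card_ker_comp hη) (hπθ ▸ card_ker_le_card_ker_comp hθ)
  have hθinj := injective_of_surjective_of_card_ker_eq hθ hπθ hcard
  exact ⟨MulEquiv.ofBijective θ ⟨hθinj, hθ⟩, hπθ⟩

end MutualEpimorphisms

section FinitelyNormallyGenerated

variable {E G : Type*} [Group E] [Group G]

theorem ker_eq_normalClosure_of_comp_eq {P : Type*} [Group P] {π : E →* G} {φ : P →* G}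
    {ψ : P →* E} (hψ : π.comp ψ = φ) {S : Set P} (hS : Subgroup.normalClosure S = φ.ker)
    {T : Set E} (hT : Subgroup.closure T = ⊤) {w : E → P} (hw : ∀ t, φ (w t) = π t) :
    π.ker = Subgroup.normalClosure (ψ '' S ∪ (fun t => (ψ (w t))⁻¹ * t) '' T) := by
  set N := Subgroup.normalClosure (ψ '' S ∪ (fun t => (ψ (w t))⁻¹ * t) '' T)
  have hπψ (v : P) : π (ψ v) = φ v := DFunLike.congr_fun hψ v
  have le_ker : N ≤ π.ker := by
    refine Subgroup.normalClosure_le_normal (Set.union_subset ?_ ?_)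
    · rintro _ ⟨s, hs, rfl⟩
      exact (hπψ s).trans (hS ▸ Subgroup.subset_normalClosure hs : s ∈ φ.ker)
    · rintro _ ⟨t, _, rfl⟩
      simp [hπψ, hw]
  have map_relations : φ.ker ≤ N.comap ψ := hS ▸ Subgroup.normalClosure_le_normal fun s hs =>
    Subgroup.subset_normalClosure (.inl ⟨s, hs, rfl⟩)
  have surjective_mod : Subgroup.closure T ≤ ((QuotientGroup.mk' N).comp ψ).range.comap
      (QuotientGroup.mk' N) := (Subgroup.closure_le _).2 fun t ht =>
    ⟨w t, QuotientGroup.eq.2 <| Subgroup.subset_normalClosure (.inr ⟨t, ht, rfl⟩)⟩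
  refine le_antisymm (fun a ha => ?_) le_ker
  obtain ⟨v, hv⟩ := surjective_mod (hT ▸ Subgroup.mem_top a)
  have diff_mem : (ψ v)⁻¹ * a ∈ N := QuotientGroup.eq.1 hv
  have hφv : φ v = 1 := by
    simpa [hπψ, MonoidHom.mem_ker.1 ha] using MonoidHom.mem_ker.1 (le_ker diff_mem)
  exact (N.mul_mem_cancel_left (N.inv_mem (map_relations hφv))).1 diff_mem

theorem isFinitelyNormallyGenerated_ker [Group.FG E] [Group.IsFinitelyPresented G]
    {π : E →* G} (hπ : Function.Surjective π) : π.ker.IsFinitelyNormallyGenerated := by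
  obtain ⟨n, φ, hφ, S, hSfin, hS⟩ := Group.IsFinitelyPresented.out (G := G)
  obtain ⟨T, hT, hTfin⟩ := Group.fg_iff.1 ‹Group.FG E›
  choose y hy using fun i => hπ (φ (FreeGroup.of i))
  choose w hw using fun t => hφ (π t)
  have lift_comp : π.comp (FreeGroup.lift y) = φ := FreeGroup.ext_hom _ _ fun i => by simp [hy]
  exact ⟨_, (hSfin.image _).union (hTfin.image _),
    (ker_eq_normalClosure_of_comp_eq lift_comp hS hT hw).symm⟩

theorem finite_conjugatesOf (a : E) [(Subgroup.centralizer {a}).FiniteIndex] :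
    (conjugatesOf a).Finite := by
  refine (Set.finite_range fun q : E ⧸ Subgroup.centralizer {a} => q.out * a * q.out⁻¹).subset ?_
  intro b hb
  obtain ⟨c, rfl⟩ := isConj_iff.1 hb
  obtain ⟨z, hz⟩ := QuotientGroup.mk_out_eq_mul (Subgroup.centralizer {a}) c
  have hza : z * a = a * z := Subgroup.mem_centralizer_singleton_iff.1 z.2
  refine ⟨c, ?_⟩
  dsimp only
  rw [hz, mul_assoc c, hza]
  group

theorem fg_normalClosure {S : Set E} (hS : S.Finite)
    (hSE : ∀ s ∈ S, (Subgroup.centralizer {s}).FiniteIndex) :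
    (Subgroup.normalClosure S).FG :=
  Subgroup.fg_iff _ |>.2 ⟨Group.conjugatesOfSet S, rfl, hS.biUnion fun s hs =>
    have := hSE s hs
    finite_conjugatesOf s⟩

end FinitelyNormallyGenerated

section Cover

open scoped commutatorElement

variable {E F G : Type*} [Group E] [Group F] [Group G]

/-- An extension `π : E → G` whose kernel has exponent dividing `m` and is centralized by the
preimage of the Fitting subgroup of `G`. The covering groups of `G` are the universal extensions
of this kind. Surjectivity of `π` is not part of the definition. -/
structure IsFittingCentral (π : E →* G) (m : ℕ) : Prop where
  commute : ∀ a b, a ∈ π.ker → π b ∈ fittingSubgroup G → Commute a b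
  pow_eq_one : ∀ a ∈ π.ker, a ^ m = 1

theorem IsFittingCentral.coverKernel_le_ker {π : E →* G} {m : ℕ} (hπ : IsFittingCentral π m)
    {μ : F →* G} {φ : F →* E} (hφ : π.comp φ = μ) : coverKernel μ m ≤ φ.ker := by
  subst hφ
  refine sup_le (Subgroup.commutator_le.2 fun x hx y hy => ?_) ((Subgroup.closure_le _).2 ?_)
  · rw [MonoidHom.mem_ker, map_commutatorElement, commutatorElement_eq_one_iff_commute]
    exact hπ.commute _ _ hx hy
  · rintro _ ⟨x, hx, rfl⟩
    exact (map_pow φ x m).trans (hπ.pow_eq_one _ hx)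

theorem IsFittingCentral.finite_ker [Group.FG E] [Group.IsFinitelyPresented G]
    [(fittingSubgroup G).FiniteIndex] {π : E →* G} (hsurj : Function.Surjective π) {m : ℕ}
    (hm : m ≠ 0) (hπ : IsFittingCentral π m) : Finite π.ker := by
  obtain ⟨S, hS, hSπ⟩ := isFinitelyNormallyGenerated_ker hsurj
  have centralizer_finiteIndex (s : E) (hs : s ∈ S) :
      (Subgroup.centralizer {s}).FiniteIndex := by
    have : ((fittingSubgroup G).comap π).FiniteIndex :=
      ⟨(Subgroup.index_comap_of_surjective _ hsurj).trans_ne Subgroup.FiniteIndex.index_ne_zero⟩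
    refine Subgroup.finiteIndex_of_le (H := (fittingSubgroup G).comap π) fun b hb => ?_
    rw [Subgroup.mem_centralizer_singleton_iff]
    exact (hπ.commute s b (hSπ ▸ Subgroup.subset_normalClosure hs) hb).symm
  have : Group.FG π.ker :=
    (Group.fg_iff_subgroup_fg _).2 (hSπ ▸ fg_normalClosure hS centralizer_finiteIndex)
  let _ : CommGroup π.ker :=
    { mul_comm a b := Subtype.ext (hπ.commute a b a.2 (b.2.symm ▸ one_mem _)) }
  exact CommGroup.finite_of_fg_isMulTorsion _ fun a =>
    isOfFinOrder_iff_pow_eq_one.2 ⟨m, hm.bot_lt, Subtype.ext (hπ.pow_eq_one a a.2)⟩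

theorem coverKernel_le_ker (μ : F →* G) (m : ℕ) : coverKernel μ m ≤ μ.ker := by
  refine sup_le (Subgroup.commutator_le_left _ _) ((Subgroup.closure_le _).2 ?_)
  rintro _ ⟨x, hx, rfl⟩
  exact μ.ker.pow_mem hx m

/-- The homomorphism from the covering group `F / [R, L] R ^ m` to `G` induced by `μ`. It makes the
covering group an extension of `G` when `μ` is surjective. -/
def coverProjection (μ : F →* G) (m : ℕ) : F ⧸ coverKernel μ m →* G :=
  QuotientGroup.lift _ μ (coverKernel_le_ker μ m)

theorem coverProjection_surjective {μ : F →* G} (hμ : Function.Surjective μ) (m : ℕ) :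
    Function.Surjective (coverProjection μ m) :=
  QuotientGroup.lift_surjective_of_surjective _ μ hμ _

theorem isFittingCentral_coverProjection (μ : F →* G) (m : ℕ) :
    IsFittingCentral (coverProjection μ m) m where
  commute a b ha hb := by
    obtain ⟨x, rfl⟩ := QuotientGroup.mk_surjective a
    obtain ⟨y, rfl⟩ := QuotientGroup.mk_surjective b
    exact commutatorElement_eq_one_iff_commute.1 <| (QuotientGroup.eq_one_iff ⁅x, y⁆).2 <|
      Subgroup.mem_sup_left (Subgroup.commutator_mem_commutator ha hb)
  pow_eq_one a ha := by
    obtain ⟨x, rfl⟩ := QuotientGroup.mk_surjective a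
    exact (QuotientGroup.eq_one_iff (x ^ m)).2 <|
      Subgroup.mem_sup_right (Subgroup.subset_closure ⟨x, ha, rfl⟩)

theorem exists_surjective_comp_eq_coverProjection {ι : Type*} [Finite ι] {π : E →* G} {m : ℕ}
    (hπ : IsFittingCentral π m) [Finite π.ker] (hsurj : Function.Surjective π)
    {ψ : FreeGroup ι →* E} (hψ : Function.Surjective ψ)
    {μ : FreeGroup ι →* G} (hμ : Function.Surjective μ) :
    ∃ θ : FreeGroup ι ⧸ coverKernel μ m →* E,
      Function.Surjective θ ∧ π.comp θ = coverProjection μ m := by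
  obtain ⟨φ, hφ, hπφ⟩ := exists_surjective_lift_of_finite_ker hsurj hψ hμ
  have hle := hπ.coverKernel_le_ker hπφ
  exact ⟨QuotientGroup.lift _ φ hle, QuotientGroup.lift_surjective_of_surjective _ φ hφ hle,
    QuotientGroup.monoidHom_ext _ hπφ⟩

end Cover

theorem natCore_ne_zero (m : ℕ) : natCore m ≠ 0 :=
  Finset.prod_ne_zero_iff.2 fun _ hp => (Nat.prime_of_mem_primeFactors hp).ne_zero

theorem mainTheorem5_general {ι G : Type*} [Finite ι] [Group G] [Group.IsFinitelyPresented G]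
    [(fittingSubgroup G).FiniteIndex] {μ₁ μ₂ : FreeGroup ι →* G}
    (h₁ : Function.Surjective μ₁) (h₂ : Function.Surjective μ₂) {m : ℕ} (hm : m ≠ 0) :
    ∃ e : FreeGroup ι ⧸ coverKernel μ₁ m ≃* FreeGroup ι ⧸ coverKernel μ₂ m,
      (coverProjection μ₂ m).comp e.toMonoidHom = coverProjection μ₁ m := by
  have central₁ := isFittingCentral_coverProjection μ₁ m
  have central₂ := isFittingCentral_coverProjection μ₂ m
  have surj₁ := coverProjection_surjective h₁ m
  have surj₂ := coverProjection_surjective h₂ m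
  have := central₁.finite_ker surj₁ hm
  have := central₂.finite_ker surj₂ hm
  obtain ⟨θ, hθ, hπθ⟩ := exists_surjective_comp_eq_coverProjection central₂ surj₂
    (QuotientGroup.mk'_surjective _) h₁
  obtain ⟨η, hη, hπη⟩ := exists_surjective_comp_eq_coverProjection central₁ surj₁
    (QuotientGroup.mk'_surjective _) h₂
  exact exists_mulEquiv_of_surjective_of_surjective hθ hπθ hη hπη

theorem mainTheorem5 {G : Type*} [Group G] [Finite G] (n : ℕ)
    (μ₁ μ₂ : FreeGroup (Fin n) →* G)
    (h₁ : Function.Surjective μ₁) (h₂ : Function.Surjective μ₂) :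
    (∀ p : ℕ, p.Prime → Nonempty (PCoveringGroup μ₁ p ≃* PCoveringGroup μ₂ p)) ∧
      Nonempty (CoveringGroup μ₁ ≃* CoveringGroup μ₂) :=
  ⟨fun _ hp => (mainTheorem5_general h₁ h₂ hp.ne_zero).nonempty,
    (mainTheorem5_general h₁ h₂ (natCore_ne_zero _)).nonempty⟩
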